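/- For an immersed surface $\Sigma$ in $\mathbb R^3$ with unit normal $\nu=(\nu_1,\nu_2,\nu_3)$, $\nu_3\neq 0$, the anisotropic mean curvature for the Dirichlet energy $\int_\Sigma F(\nu)\,d\Sigma$, $F(\nu)=\frac1{\nu_3}-\nu_3$, is $\Lambda=2HF(\nu)-\operatorname{div}_\Sigma (DF(\nu))$, where $H$ is the mean curvature and $DF$ is the gradient of $F$ on the unit sphere; $\Sigma$ is called anisotropic minimal if $\Lambda=0$ identically. Let $I\subset\mathbb R$ be an open interval and let $\mathbf c,\mathbf u,\mathbf v\colon I\to\mathbb R^3$ and $r\colon I\to(0,\infty)$ be smooth, with $\mathbf u(s),\mathbf v(s)$ orthonormal for every $s$. They describe a smooth one-parameter family of circles, in the planes $P_s=\mathbf c(s)+\operatorname{span}\{\mathbf u(s),\mathbf v(s)\}$ (the planes of the foliation), swept out by $$X(s,\theta)=\mathbf c(s)+r(s)\bigl(\cos\theta\,\mathbf u(s)+\sin\theta\,\mathbf v(s)\bigr).$$ Let $U\subset I\times\mathbb R$ be an open set that contains, for every $s\in I$, a point $(s,\theta)$ (for instance $U=I\times\mathbb R$), and suppose that $X$ is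 an immersion with $\nu_3\neq0$ on $U$, so that $\Sigma=X(U)$ is a cyclic surface. **Theorem.** If the cyclic surface $\Sigma$ is anisotropic minimal for the Dirichlet energy and is not contained in a plane, then all planes $P_s$, $s\in I$, of the foliation are parallel to the $xy$-plane. -/

import Mathlib

open scoped ContDiff Matrix

noncomputable section

/-- Euclidean space `ℝ³`, with coordinates `(x, y, z) = (p 0, p 1, p 2)`. -/
abbrev E3 : Type := EuclideanSpace ℝ (Fin 3)

/-- The cross product of `ℝ³`. -/
def cross (v w : E3) : E3 := WithLp.toLp 2 (v.ofLp ⨯₃ w.ofLp)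

/-! ### Differential geometry of a parametrized surface `X = X(s, θ)` -/

/-- The partial derivative in the first variable `s`. -/
def partialS (X : ℝ → ℝ → E3) (s θ : ℝ) : E3 := deriv (fun t => X t θ) s

/-- The partial derivative in the second variable `θ`. -/
def partialT (X : ℝ → ℝ → E3) (s θ : ℝ) : E3 := deriv (fun t => X s t) θ

/-- The normal vector `X_s × X_θ` (nonzero exactly where `X` is an immersion). -/
def normalVec (X : ℝ → ℝ → E3) (s θ : ℝ) : E3 := cross (partialS X s θ) (partialT X s θ)

/-- The unit normal `ν = (X_s × X_θ) / |X_s × X_θ|`. -/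
def unitNormal (X : ℝ → ℝ → E3) (s θ : ℝ) : E3 :=
  ‖normalVec X s θ‖⁻¹ • normalVec X s θ

/-- The trace `∑ g^{ij} b_{ij}` of a (possibly non-symmetric) bilinear form on the tangent plane,
with coefficients `b_{ij}` in the basis `X_s, X_θ`, with respect to the first fundamental form. -/
def metricTrace (X : ℝ → ℝ → E3) (s θ b₁₁ b₁₂ b₂₁ b₂₂ : ℝ) : ℝ :=
  let E := inner ℝ (partialS X s θ) (partialS X s θ)
  let F := inner ℝ (partialS X s θ) (partialT X s θ)
  let G := inner ℝ (partialT X s θ) (partialT X s θ)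
  (G * b₁₁ - F * b₁₂ - F * b₂₁ + E * b₂₂) / (E * G - F ^ 2)

/-- The mean curvature `H`: half the trace of the second fundamental form
`h(X_i, X_j) = ⟨ν, X_{ij}⟩`. -/
def meanCurvature (X : ℝ → ℝ → E3) (s θ : ℝ) : ℝ :=
  metricTrace X s θ
    (inner ℝ (unitNormal X s θ) (partialS (partialS X) s θ))
    (inner ℝ (unitNormal X s θ) (partialT (partialS X) s θ))
    (inner ℝ (unitNormal X s θ) (partialS (partialT X) s θ))
    (inner ℝ (unitNormal X s θ) (partialT (partialT X) s θ)) / 2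

/-- The divergence `div_Σ V = ∑ g^{ij} ⟨∂_i V, X_j⟩` of a vector field `V` along the surface. -/
def surfaceDiv (X V : ℝ → ℝ → E3) (s θ : ℝ) : ℝ :=
  metricTrace X s θ
    (inner ℝ (partialS V s θ) (partialS X s θ))
    (inner ℝ (partialS V s θ) (partialT X s θ))
    (inner ℝ (partialT V s θ) (partialS X s θ))
    (inner ℝ (partialT V s θ) (partialT X s θ))

/-! ### Anisotropic surface energies -/

/-- The gradient `DF` on the unit sphere, at a unit vector `ν`, of (the restriction of) `F`:
the component of the Euclidean gradient tangent to the sphere. It depends only on the values of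
`F` on the sphere. -/
def sphereGradient (F : E3 → ℝ) (ν : E3) : E3 :=
  gradient F ν - (inner ℝ (gradient F ν) ν : ℝ) • ν

/-- The anisotropic mean curvature `Λ = 2 H F(ν) - div_Σ (DF(ν))` of the surface `X` for the
energy `∫ F(ν) dΣ`. -/
def anisotropicMeanCurvature (F : E3 → ℝ) (X : ℝ → ℝ → E3) (s θ : ℝ) : ℝ :=
  2 * meanCurvature X s θ * F (unitNormal X s θ)
    - surfaceDiv X (fun s' θ' => sphereGradient F (unitNormal X s' θ')) s θ

/-- The density `F(ν) = 1/ν₃ - ν₃` of the Dirichlet energy (meaningful where `ν₃ ≠ 0`). -/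
def dirichletDensity (ν : E3) : ℝ := 1 / ν 2 - ν 2

/-- The surface parametrized by `X` on `U` is an anisotropic minimal surface of the Dirichlet
energy: `X` is an immersion on `U`, its unit normal stays in the domain `ν₃ ≠ 0` of the density,
and `Λ = 0`. -/
def IsDirichletMinimalOn (X : ℝ → ℝ → E3) (U : Set (ℝ × ℝ)) : Prop :=
  ∀ p ∈ U, normalVec X p.1 p.2 ≠ 0 ∧ unitNormal X p.1 p.2 2 ≠ 0 ∧
    anisotropicMeanCurvature dirichletDensity X p.1 p.2 = 0

/-! ### Cyclic surfaces -/

/-- A smooth one-parameter family of circles of `ℝ³`, with parameter `s` in an open interval `I`: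
the circle of parameter `s` has centre `c s` and radius `r s > 0`, and lies in the plane through
`c s` spanned by the orthonormal vectors `u s`, `v s`. -/
structure CircleFamily where
  I : Set ℝ
  isOpen_I : IsOpen I
  ordConnected_I : I.OrdConnected
  c : ℝ → E3
  r : ℝ → ℝ
  u : ℝ → E3
  v : ℝ → E3
  smooth_c : ContDiffOn ℝ ∞ c I
  smooth_r : ContDiffOn ℝ ∞ r I
  smooth_u : ContDiffOn ℝ ∞ u I
  smooth_v : ContDiffOn ℝ ∞ v I
  r_pos : ∀ s ∈ I, 0 < r s
  norm_u : ∀ s ∈ I, ‖u s‖ = 1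
  norm_v : ∀ s ∈ I, ‖v s‖ = 1
  inner_u_v : ∀ s ∈ I, inner ℝ (u s) (v s) = 0

/-- The map `X(s, θ) = c(s) + r(s) (cos θ u(s) + sin θ v(s))` swept out by the circles. -/
def CircleFamily.param (C : CircleFamily) (s θ : ℝ) : E3 :=
  C.c s + C.r s • (Real.cos θ • C.u s + Real.sin θ • C.v s)

/-- The plane of the foliation containing the circle of parameter `s`. -/
def CircleFamily.plane (C : CircleFamily) (s : ℝ) : AffineSubspace ℝ E3 :=
  AffineSubspace.mk' (C.c s) (Submodule.span ℝ {C.u s, C.v s})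

/-- `U` is an admissible parameter domain for a surface foliated by the circles of `C`: an open
subset of `I × ℝ` that meets every circle. The choice `U = I × ℝ` gives the whole circles; smaller
`U` allow to leave out points, for instance those where `ν₃ = 0`. -/
def CircleFamily.IsDomain (C : CircleFamily) (U : Set (ℝ × ℝ)) : Prop :=
  IsOpen U ∧ (∀ p ∈ U, p.1 ∈ C.I) ∧ ∀ s ∈ C.I, ∃ θ, (s, θ) ∈ U

/-- The surface `X(U)` in `ℝ³`. -/
def CircleFamily.surface (C : CircleFamily) (U : Set (ℝ × ℝ)) : Set E3 :=
  (fun p : ℝ × ℝ => C.param p.1 p.2) '' U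

/-- The `xy`-plane `{z = 0}`. -/
def xyPlane : AffineSubspace ℝ E3 :=
  AffineSubspace.mk' 0
    (Submodule.span ℝ {EuclideanSpace.single 0 1, EuclideanSpace.single 1 1})

end

/-!
Away from vertical tangent planes the surface is a graph `z = f(x, y)`, and `Λ` is a nonzero
multiple of `Δf`. In the parameters `(s, θ)` the equation `Δf = 0` becomes a trigonometric
polynomial identity in `θ`, which holds on an open set of angles and hence, with `ζ = e^{iθ}`, for
all `ζ ∈ ℂ` once denominators are cleared. Write `w = r (u + i v)`, an isotropic vector of `ℂ³`. The
value at `ζ = 0` is a multiple of `w₃² det(w, w', w'')`; if `w₃ ≠ 0` this forces `w × w' = 0`, so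
that a nonhorizontal plane of the foliation does not turn. The remaining identity, averaged over
antipodal points and compared at the highest point of the circle and a quarter turn away, shows that
the centre moves inside the plane, since otherwise it would move vertically and `ν₃` would vanish.
The inclination of the planes is therefore constant, and if it is not zero all circles lie in one
plane.
-/

section Isotropic

variable {K : Type*} [Field K]

theorem exists_eq_smul_of_crossProduct_eq_zero {w₀ w₁ : Fin 3 → K} (h₀ : w₀ ≠ 0)
    (h : w₀ ⨯₃ w₁ = 0) : ∃ k : K, w₁ = k • w₀ := by
  have hdep : ¬ LinearIndependent K ![w₀, w₁] := fun hli =>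
    crossProduct_ne_zero_iff_linearIndependent.2 hli h
  rw [LinearIndependent.pair_iff' h₀] at hdep
  push Not at hdep
  exact hdep.imp fun k hk => hk.symm

theorem crossProduct_eq_zero_of_isotropic_jet {w₀ w₁ w₂ : Fin 3 → K} (h₀₀ : w₀ ⬝ᵥ w₀ = 0)
    (h₀₁ : w₀ ⬝ᵥ w₁ = 0) (h₀₂ : w₁ ⬝ᵥ w₁ + w₀ ⬝ᵥ w₂ = 0) (hdet : w₀ ⨯₃ w₁ ⬝ᵥ w₂ = 0) :
    w₀ ⨯₃ w₁ = 0 := by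
  rcases eq_or_ne w₀ 0 with rfl | hw₀
  · simp
  have hperp : w₀ ⨯₃ (w₀ ⨯₃ w₁) = 0 := by
    rw [← cross_anticomm, cross_cross_eq_smul_sub_smul, h₀₀, dotProduct_comm w₁, h₀₁]
    simp
  obtain ⟨ζ, hζ⟩ := exists_eq_smul_of_crossProduct_eq_zero hw₀ hperp
  have hζ₁ : ζ * (w₁ ⬝ᵥ w₁) = 0 := by
    rw [hζ, smul_dotProduct, smul_eq_mul] at hdet
    linear_combination ζ * h₀₂ - hdet
  rcases mul_eq_zero.1 hζ₁ with rfl | h₁₁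
  · rw [hζ, zero_smul]
  · have hcross : ζ • (w₀ ⨯₃ w₁) = 0 := by
      rw [← LinearMap.smul_apply, ← map_smul, ← hζ, cross_cross_eq_smul_sub_smul, h₀₁, h₁₁]
      simp
    rcases smul_eq_zero.1 hcross with rfl | h
    · rw [hζ, zero_smul]
    · exact h

end Isotropic

section LaplaceDefect

variable {K : Type*} [CommRing K]

/-- The Laplace operator of a parametrized surface, as a polynomial in the first partial
derivatives `p = X_s`, `q = X_θ` and the second partial derivatives `a = X_ss`, `b = X_sθ`,
`d = X_θθ`. If `X` is the graph of `z = f(x, y)` in other parameters, this is `Δf` times the cube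
of the Jacobian of `(s, θ) ↦ (x, y)`. The coefficients are taken in an arbitrary ring so that the
expression can be evaluated at complex values of `e^{iθ}`. -/
def laplaceDefect (p q a b d : Fin 3 → K) : K :=
  (q 0 ^ 2 + q 1 ^ 2) * (p ⨯₃ q ⬝ᵥ a) - 2 * (p 0 * q 0 + p 1 * q 1) * (p ⨯₃ q ⬝ᵥ b)
    + (p 0 ^ 2 + p 1 ^ 2) * (p ⨯₃ q ⬝ᵥ d)

theorem cross_dotProduct (p q a : Fin 3 → K) :
    p ⨯₃ q ⬝ᵥ a = (p 1 * q 2 - p 2 * q 1) * a 0 + (p 2 * q 0 - p 0 * q 2) * a 1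
      + (p 0 * q 1 - p 1 * q 0) * a 2 := by
  simp [cross_apply, dotProduct, Fin.sum_univ_three]

theorem laplaceDefect_smul (t : K) (p q a b d : Fin 3 → K) :
    laplaceDefect (t • p) (t • q) (t • a) (t • b) (t • d) = t ^ 5 * laplaceDefect p q a b d := by
  simp only [laplaceDefect, cross_dotProduct, Pi.smul_apply, smul_eq_mul]
  ring

theorem laplaceDefect_map {L : Type*} [CommRing L] (φ : K →+* L) (p q a b d : Fin 3 → K) :
    laplaceDefect (φ ∘ p) (φ ∘ q) (φ ∘ a) (φ ∘ b) (φ ∘ d) = φ (laplaceDefect p q a b d) := by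
  simp only [laplaceDefect, cross_dotProduct, Function.comp_apply, map_add, map_sub, map_mul,
    map_pow, map_ofNat]

theorem laplaceDefect_of_cone (t t' : K) (w₀ w₁ w₂ : Fin 3 → K) :
    laplaceDefect w₁ (t • w₀) w₂ (t • w₁) (t' • w₀) =
      -t ^ 3 * (w₀ 0 ^ 2 + w₀ 1 ^ 2) * (w₀ ⨯₃ w₁ ⬝ᵥ w₂) := by
  simp only [laplaceDefect, cross_dotProduct, Pi.smul_apply, smul_eq_mul]
  ring

theorem laplaceDefect_of_stationary_plane (c₁ c₂ e f : Fin 3 → K) (μ φ κ κ' : K) :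
    laplaceDefect (c₁ + (μ • e - φ • f)) f (c₂ + (κ • e - κ' • f)) (φ • e + μ • f) (-e) =
      (f 0 ^ 2 + f 1 ^ 2) *
          (c₁ ⨯₃ f ⬝ᵥ c₂ + μ * (e ⨯₃ f ⬝ᵥ c₂) - (κ + φ ^ 2) * (e ⨯₃ f ⬝ᵥ c₁))
        + (e ⨯₃ f ⬝ᵥ c₁) * ((c₁ 0 + μ * e 0) ^ 2 + (c₁ 1 + μ * e 1) ^ 2) := by
  simp only [laplaceDefect, cross_dotProduct, Pi.add_apply, Pi.sub_apply, Pi.neg_apply,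
    Pi.smul_apply, smul_eq_mul]
  ring

end LaplaceDefect

section SweptEllipses

open Complex ComplexConjugate Filter Topology

/-- The point `cos θ • Re w + sin θ • Im w` of the ellipse with conjugate radii `Re w` and `Im w`.
Encoding the two radii by one complex vector makes both `∂/∂θ` and the similarities of the plane of
the ellipse multiplications by complex numbers; the ellipse is a circle exactly when
`w ⬝ᵥ w = 0`. -/
noncomputable def ellipsePoint (θ : ℝ) (w : Fin 3 → ℂ) : Fin 3 → ℝ :=
  fun i => (exp (-(θ * I)) * w i).re

theorem ellipsePoint_apply (θ : ℝ) (w : Fin 3 → ℂ) (i : Fin 3) :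
    ellipsePoint θ w i = Real.cos θ * (w i).re + Real.sin θ * (w i).im := by
  rw [ellipsePoint, ← neg_mul, ← ofReal_neg, mul_re, exp_ofReal_mul_I_re, exp_ofReal_mul_I_im]
  simp

theorem ellipsePoint_tangent_apply (θ : ℝ) (w : Fin 3 → ℂ) (i : Fin 3) :
    ellipsePoint θ (-I • w) i = Real.cos θ * (w i).im - Real.sin θ * (w i).re := by
  simp [ellipsePoint_apply, sub_eq_add_neg]

theorem ellipsePoint_smul (θ : ℝ) (k : ℂ) (w : Fin 3 → ℂ) :
    ellipsePoint θ (k • w) = k.re • ellipsePoint θ w - k.im • ellipsePoint θ (-I • w) := by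
  funext i
  rw [Pi.sub_apply, Pi.smul_apply, Pi.smul_apply, ellipsePoint_tangent_apply]
  simp only [ellipsePoint_apply, Pi.smul_apply, smul_eq_mul, mul_re, mul_im]
  ring

theorem ellipsePoint_add_pi (θ : ℝ) (w : Fin 3 → ℂ) :
    ellipsePoint (θ + Real.pi) w = -ellipsePoint θ w := by
  funext i
  simp only [Pi.neg_apply, ellipsePoint_apply, Real.cos_add_pi, Real.sin_add_pi]
  ring

theorem ellipsePoint_add_pi_div_two (θ : ℝ) (w : Fin 3 → ℂ) :
    ellipsePoint (θ + Real.pi / 2) w = ellipsePoint θ (-I • w) := by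
  funext i
  rw [ellipsePoint_tangent_apply, ellipsePoint_apply, Real.cos_add_pi_div_two,
    Real.sin_add_pi_div_two]
  ring

theorem exp_neg_arg_mul_I_mul_self (z : ℂ) : exp (-(z.arg * I)) * z = ‖z‖ := by
  nth_rewrite 2 [← norm_mul_exp_arg_mul_I z]
  rw [mul_left_comm, ← exp_add, neg_add_cancel, exp_zero, mul_one]

theorem ellipsePoint_arg (w : Fin 3 → ℂ) (i : Fin 3) : ellipsePoint (w i).arg w i = ‖w i‖ := by
  rw [ellipsePoint, exp_neg_arg_mul_I_mul_self, ofReal_re]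

theorem ellipsePoint_arg_tangent (w : Fin 3 → ℂ) (i : Fin 3) :
    ellipsePoint (w i).arg (-I • w) i = 0 := by
  rw [ellipsePoint, Pi.smul_apply, smul_eq_mul, mul_left_comm, exp_neg_arg_mul_I_mul_self]
  simp

theorem hasDerivAt_ellipsePoint_angle (w : Fin 3 → ℂ) (θ : ℝ) :
    HasDerivAt (fun t => ellipsePoint t w) (ellipsePoint θ (-I • w)) θ := by
  refine hasDerivAt_pi.2 fun i => ?_
  rw [ellipsePoint_tangent_apply]
  simp only [ellipsePoint_apply]
  refine (((Real.hasDerivAt_cos θ).mul_const _).add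
    ((Real.hasDerivAt_sin θ).mul_const _)).congr_deriv ?_
  ring

theorem hasDerivAt_ellipsePoint {w : ℝ → Fin 3 → ℂ} {w' : Fin 3 → ℂ} {s : ℝ}
    (hw : HasDerivAt w w' s) (θ : ℝ) :
    HasDerivAt (fun t => ellipsePoint θ (w t)) (ellipsePoint θ w') s :=
  hasDerivAt_pi.2 fun i =>
    reCLM.hasFDerivAt.comp_hasDerivAt s ((hasDerivAt_pi.1 hw i).const_mul (exp (-(θ * I))))

theorem crossProduct_ellipsePoint (θ : ℝ) (w : Fin 3 → ℂ) :
    ellipsePoint θ w ⨯₃ ellipsePoint θ (-I • w) = (re ∘ w) ⨯₃ (im ∘ w) := by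
  have hminor (i j : Fin 3) :
      ellipsePoint θ w i * ellipsePoint θ (-I • w) j
        - ellipsePoint θ w j * ellipsePoint θ (-I • w) i =
      (w i).re * (w j).im - (w j).re * (w i).im := by
    rw [ellipsePoint_tangent_apply, ellipsePoint_tangent_apply, ellipsePoint_apply,
      ellipsePoint_apply]
    linear_combination
      ((w i).re * (w j).im - (w j).re * (w i).im) * Real.cos_sq_add_sin_sq θ
  simp only [cross_apply, hminor, Function.comp_apply]

theorem ellipsePoint_dotProduct_self {w : Fin 3 → ℂ} (hw : w ⬝ᵥ w = 0) (θ : ℝ) :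
    ellipsePoint θ w ⬝ᵥ ellipsePoint θ w =
      ellipsePoint θ (-I • w) ⬝ᵥ ellipsePoint θ (-I • w) := by
  have hre := congrArg re hw
  have him := congrArg im hw
  simp only [dotProduct, Fin.sum_univ_three, add_re, add_im, mul_re, mul_im, zero_re, zero_im]
    at hre him
  simp only [dotProduct, Fin.sum_univ_three, ellipsePoint_tangent_apply]
  simp only [ellipsePoint_apply]
  linear_combination (Real.cos θ ^ 2 - Real.sin θ ^ 2) * hre + 2 * Real.cos θ * Real.sin θ * him

/-- The value at `z` of the polynomial that interpolates `2 z (c + ellipsePoint θ w)` at the points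
`z = e^{iθ}` of the unit circle. -/
def circleExtension (z : ℂ) (c : Fin 3 → ℝ) (w : Fin 3 → ℂ) : Fin 3 → ℂ :=
  fun i => 2 * z * c i + (w i + z ^ 2 * conj (w i))

theorem circleExtension_zero (c : Fin 3 → ℝ) (w : Fin 3 → ℂ) : circleExtension 0 c w = w := by
  funext i
  simp [circleExtension]

theorem circleExtension_exp (θ : ℝ) (c : Fin 3 → ℝ) (w : Fin 3 → ℂ) :
    circleExtension (exp (θ * I)) c w =
      (2 * exp (θ * I)) • (ofRealHom ∘ (c + ellipsePoint θ w)) := by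
  funext i
  have hconj : conj (exp (-(θ * I))) = exp (θ * I) := by
    rw [← exp_conj]; simp
  have hexp : exp (θ * I) * exp (-(θ * I)) = 1 := by
    rw [← exp_add, add_neg_cancel, exp_zero]
  have hre : (ellipsePoint θ w i : ℂ) =
      (exp (-(θ * I)) * w i + exp (θ * I) * conj (w i)) / 2 := by
    rw [ellipsePoint, re_eq_add_conj, map_mul, hconj]
  simp only [circleExtension, Pi.smul_apply, Function.comp_apply, Pi.add_apply, ofRealHom_eq_coe,
    ofReal_add, smul_eq_mul, hre]
  linear_combination -(w i) * hexp

theorem eq_zero_of_eventually_circle_eq_zero {R : ℂ → ℂ} (hR : Differentiable ℂ R) {θ₀ : ℝ}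
    (h : ∀ᶠ θ : ℝ in 𝓝 θ₀, R (exp (θ * I)) = 0) (z : ℂ) : R z = 0 := by
  have hder : HasDerivAt (fun θ : ℝ => exp (θ * I)) (exp (θ₀ * I) * I) θ₀ := by
    simpa using ((ofRealCLM.hasDerivAt (x := θ₀)).mul_const I).cexp
  have hfreq : ∃ᶠ z in 𝓝[≠] exp (θ₀ * I), R z = 0 :=
    (hder.tendsto_nhdsNE (by simp)).frequently (h.filter_mono nhdsWithin_le_nhds).frequently
  have hanalytic : AnalyticOnNhd ℂ R Set.univ := hR.differentiableOn.analyticOnNhd isOpen_univ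
  exact hanalytic.eqOn_zero_of_preconnected_of_frequently_eq_zero isPreconnected_univ
    (Set.mem_univ _) hfreq (Set.mem_univ z)

/-- The Laplace operator, in the sense of `laplaceDefect`, at angle `θ` of the surface
`c(s) + ellipsePoint θ (w(s))` swept out by ellipses, in terms of the derivatives `c₁ = c'`,
`c₂ = c''`, `w₀ = w`, `w₁ = w'` and `w₂ = w''`. -/
noncomputable def sweptLaplaceDefect (c₁ c₂ : Fin 3 → ℝ) (w₀ w₁ w₂ : Fin 3 → ℂ) (θ : ℝ) : ℝ :=
  laplaceDefect (c₁ + ellipsePoint θ w₁) (ellipsePoint θ (-I • w₀)) (c₂ + ellipsePoint θ w₂)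
    (ellipsePoint θ (-I • w₁)) (ellipsePoint θ (-w₀))

variable {c₁ c₂ : Fin 3 → ℝ} {w₀ w₁ w₂ : Fin 3 → ℂ}

/-- The polynomial in `z` that interpolates `(2 z) ^ 5 * sweptLaplaceDefect` at `z = e^{iθ}`. -/
def complexSweptLaplaceDefect (c₁ c₂ : Fin 3 → ℝ) (w₀ w₁ w₂ : Fin 3 → ℂ) (z : ℂ) : ℂ :=
  laplaceDefect (circleExtension z c₁ w₁) (circleExtension z 0 (-I • w₀))
    (circleExtension z c₂ w₂) (circleExtension z 0 (-I • w₁)) (circleExtension z 0 (-w₀))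

theorem complexSweptLaplaceDefect_exp (θ : ℝ) :
    complexSweptLaplaceDefect c₁ c₂ w₀ w₁ w₂ (exp (θ * I)) =
      (2 * exp (θ * I)) ^ 5 * sweptLaplaceDefect c₁ c₂ w₀ w₁ w₂ θ := by
  simp only [complexSweptLaplaceDefect, circleExtension_exp, laplaceDefect_smul, laplaceDefect_map,
    zero_add, ofRealHom_eq_coe, sweptLaplaceDefect]

theorem complexSweptLaplaceDefect_zero :
    complexSweptLaplaceDefect c₁ c₂ w₀ w₁ w₂ 0 =
      (-I) * (w₀ 0 ^ 2 + w₀ 1 ^ 2) * (w₀ ⨯₃ w₁ ⬝ᵥ w₂) := by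
  simp only [complexSweptLaplaceDefect, circleExtension_zero]
  rw [← neg_one_smul ℂ w₀, laplaceDefect_of_cone, Odd.neg_pow (by decide), neg_neg, I_pow_three]

theorem differentiable_complexSweptLaplaceDefect :
    Differentiable ℂ (complexSweptLaplaceDefect c₁ c₂ w₀ w₁ w₂) := by
  unfold complexSweptLaplaceDefect
  simp only [laplaceDefect, cross_dotProduct, circleExtension]
  fun_prop

theorem complexSweptLaplaceDefect_eq_zero {θ₀ : ℝ}
    (h : ∀ᶠ θ in 𝓝 θ₀, sweptLaplaceDefect c₁ c₂ w₀ w₁ w₂ θ = 0) (z : ℂ) :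
    complexSweptLaplaceDefect c₁ c₂ w₀ w₁ w₂ z = 0 := by
  refine eq_zero_of_eventually_circle_eq_zero differentiable_complexSweptLaplaceDefect
    (h.mono fun θ hθ => ?_) z
  rw [complexSweptLaplaceDefect_exp, hθ, ofReal_zero, mul_zero]

theorem sweptLaplaceDefect_eq_zero {θ₀ : ℝ}
    (h : ∀ᶠ θ in 𝓝 θ₀, sweptLaplaceDefect c₁ c₂ w₀ w₁ w₂ θ = 0) (θ : ℝ) :
    sweptLaplaceDefect c₁ c₂ w₀ w₁ w₂ θ = 0 := by
  have hz := complexSweptLaplaceDefect_eq_zero h (exp (θ * I))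
  rw [complexSweptLaplaceDefect_exp, mul_eq_zero] at hz
  exact_mod_cast hz.resolve_left (by simp)

theorem crossProduct_eq_zero_of_sweptLaplaceDefect_eq_zero (h₀₀ : w₀ ⬝ᵥ w₀ = 0)
    (h₀₁ : w₀ ⬝ᵥ w₁ = 0) (h₀₂ : w₁ ⬝ᵥ w₁ + w₀ ⬝ᵥ w₂ = 0) (hw₀ : w₀ 2 ≠ 0) {θ₀ : ℝ}
    (h : ∀ᶠ θ in 𝓝 θ₀, sweptLaplaceDefect c₁ c₂ w₀ w₁ w₂ θ = 0) : w₀ ⨯₃ w₁ = 0 := by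
  have hxy : w₀ 0 ^ 2 + w₀ 1 ^ 2 = -w₀ 2 ^ 2 := by
    rw [dotProduct, Fin.sum_univ_three] at h₀₀
    linear_combination h₀₀
  have hzero := complexSweptLaplaceDefect_eq_zero h 0
  rw [complexSweptLaplaceDefect_zero, hxy] at hzero
  exact crossProduct_eq_zero_of_isotropic_jet h₀₀ h₀₁ h₀₂
    ((mul_eq_zero.1 hzero).resolve_left (by simpa using hw₀))

section StationaryPlane

variable {k l : ℂ}

theorem sweptLaplaceDefect_of_stationary_plane (θ : ℝ) :
    sweptLaplaceDefect c₁ c₂ w₀ (k • w₀) (l • w₀) θ =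
      laplaceDefect
        (c₁ + (k.re • ellipsePoint θ w₀ - k.im • ellipsePoint θ (-I • w₀)))
        (ellipsePoint θ (-I • w₀))
        (c₂ + (l.re • ellipsePoint θ w₀ - l.im • ellipsePoint θ (-I • w₀)))
        (k.im • ellipsePoint θ w₀ + k.re • ellipsePoint θ (-I • w₀))
        (-ellipsePoint θ w₀) := by
  have htangent : ellipsePoint θ (-I • k • w₀) =
      k.im • ellipsePoint θ w₀ + k.re • ellipsePoint θ (-I • w₀) := by
    rw [smul_smul, ellipsePoint_smul]; simp
  have hneg : ellipsePoint θ (-w₀) = -ellipsePoint θ w₀ := by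
    rw [← neg_one_smul ℂ w₀, ellipsePoint_smul]; simp
  rw [sweptLaplaceDefect, ellipsePoint_smul θ k, ellipsePoint_smul θ l, htangent, hneg]

/-- Antipodal points of a circle have opposite `e = ellipsePoint θ w₀`, which isolates the terms of
even degree of `laplaceDefect_of_stationary_plane`. -/
theorem even_part_of_sweptLaplaceDefect_eq_zero
    (h : ∀ θ, sweptLaplaceDefect c₁ c₂ w₀ (k • w₀) (l • w₀) θ = 0) (θ : ℝ) :
    (ellipsePoint θ (-I • w₀) 0 ^ 2 + ellipsePoint θ (-I • w₀) 1 ^ 2) *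
        (k.re * ((re ∘ w₀) ⨯₃ (im ∘ w₀) ⬝ᵥ c₂)
          - (l.re + k.im ^ 2) * ((re ∘ w₀) ⨯₃ (im ∘ w₀) ⬝ᵥ c₁))
      + ((re ∘ w₀) ⨯₃ (im ∘ w₀) ⬝ᵥ c₁) * (c₁ 0 ^ 2 + c₁ 1 ^ 2
          + k.re ^ 2 * (ellipsePoint θ w₀ 0 ^ 2 + ellipsePoint θ w₀ 1 ^ 2)) = 0 := by
  have hθ := h θ
  have hantipode := h (θ + Real.pi)
  rw [sweptLaplaceDefect_of_stationary_plane, laplaceDefect_of_stationary_plane,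
    crossProduct_ellipsePoint] at hθ hantipode
  simp only [ellipsePoint_add_pi, Pi.neg_apply, map_neg, neg_dotProduct] at hantipode
  linear_combination (hθ + hantipode) / 2

theorem vertical_of_sweptLaplaceDefect_eq_zero (h₀₀ : w₀ ⬝ᵥ w₀ = 0) (hw₀ : w₀ 2 ≠ 0)
    (h : ∀ θ, sweptLaplaceDefect c₁ c₂ w₀ (k • w₀) (l • w₀) θ = 0)
    (hc₁ : (re ∘ w₀) ⨯₃ (im ∘ w₀) ⬝ᵥ c₁ ≠ 0) : k.re = 0 ∧ c₁ 0 = 0 ∧ c₁ 1 = 0 := by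
  have htop := even_part_of_sweptLaplaceDefect_eq_zero h (w₀ 2).arg
  have hside := even_part_of_sweptLaplaceDefect_eq_zero h ((w₀ 2).arg + Real.pi / 2)
  have hneg : ∀ θ, ellipsePoint θ (-I • -I • w₀) = -ellipsePoint θ w₀ := fun θ => by
    rw [← ellipsePoint_add_pi_div_two, ← ellipsePoint_add_pi_div_two, add_assoc, add_halves,
      ellipsePoint_add_pi]
  have hcircle := ellipsePoint_dotProduct_self h₀₀ (w₀ 2).arg
  have hheight := ellipsePoint_arg w₀ 2
  have hheight_pos : 0 < ‖w₀ 2‖ ^ 2 := by positivity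
  simp only [ellipsePoint_add_pi_div_two, hneg, Pi.neg_apply, neg_sq] at hside
  simp only [dotProduct, Fin.sum_univ_three, hheight, ellipsePoint_arg_tangent] at hcircle
  set e := ellipsePoint (w₀ 2).arg w₀
  set f := ellipsePoint (w₀ 2).arg (-I • w₀)
  set η := (re ∘ w₀) ⨯₃ (im ∘ w₀) ⬝ᵥ c₁
  set κ := k.re * ((re ∘ w₀) ⨯₃ (im ∘ w₀) ⬝ᵥ c₂) - (l.re + k.im ^ 2) * η
  have hκ : κ = η * k.re ^ 2 := by
    refine mul_left_cancel₀ hheight_pos.ne' ?_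
    linear_combination htop - hside + (κ - η * k.re ^ 2) * hcircle
  have hsum : c₁ 0 ^ 2 + c₁ 1 ^ 2
      + k.re ^ 2 * (e 0 ^ 2 + e 1 ^ 2 + (f 0 ^ 2 + f 1 ^ 2)) = 0 := by
    refine (mul_eq_zero.1 ?_).resolve_left hc₁
    linear_combination htop - (f 0 ^ 2 + f 1 ^ 2) * hκ
  have hpos : 0 < e 0 ^ 2 + e 1 ^ 2 + (f 0 ^ 2 + f 1 ^ 2) := by
    nlinarith [sq_nonneg (e 0), sq_nonneg (e 1)]
  obtain ⟨hxy, hk⟩ := (add_eq_zero_iff_of_nonneg (by positivity) (by positivity)).1 hsum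
  obtain ⟨hx, hy⟩ := (add_eq_zero_iff_of_nonneg (sq_nonneg _) (sq_nonneg _)).1 hxy
  exact ⟨by simpa [hpos.ne'] using hk, by simpa using hx, by simpa using hy⟩

theorem center_tangent_of_sweptLaplaceDefect_eq_zero (h₀₀ : w₀ ⬝ᵥ w₀ = 0) (hw₀ : w₀ 2 ≠ 0)
    (h : ∀ θ, sweptLaplaceDefect c₁ c₂ w₀ (k • w₀) (l • w₀) θ = 0) {θ : ℝ}
    (hnormal : ((c₁ + ellipsePoint θ (k • w₀)) ⨯₃ ellipsePoint θ (-I • w₀)) 2 ≠ 0) :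
    (re ∘ w₀) ⨯₃ (im ∘ w₀) ⬝ᵥ c₁ = 0 := by
  contrapose! hnormal with hc₁
  obtain ⟨hk, hx, hy⟩ := vertical_of_sweptLaplaceDefect_eq_zero h₀₀ hw₀ h hc₁
  rw [ellipsePoint_smul]
  simp [cross_apply, hk, hx, hy]

end StationaryPlane

end SweptEllipses

section Derivatives

variable {𝕜 A : Type*} [NontriviallyNormedField 𝕜] [NormedCommRing A] [NormedAlgebra 𝕜 A]
  {t : 𝕜}

theorem hasDerivAt_dotProduct {ι : Type*} [Fintype ι] {p q : 𝕜 → ι → A} {p' q' : ι → A}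
    (hp : HasDerivAt p p' t) (hq : HasDerivAt q q' t) :
    HasDerivAt (fun s => p s ⬝ᵥ q s) (p' ⬝ᵥ q t + p t ⬝ᵥ q') t := by
  simp only [dotProduct, ← Finset.sum_add_distrib]
  exact HasDerivAt.fun_sum fun i _ => (hasDerivAt_pi.1 hp i).mul (hasDerivAt_pi.1 hq i)

theorem hasDerivAt_crossProduct {p q : 𝕜 → Fin 3 → A} {p' q' : Fin 3 → A}
    (hp : HasDerivAt p p' t) (hq : HasDerivAt q q' t) :
    HasDerivAt (fun s => p s ⨯₃ q s) (p' ⨯₃ q t + p t ⨯₃ q') t := by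
  have hmul (i j : Fin 3) := (hasDerivAt_pi.1 hp i).mul (hasDerivAt_pi.1 hq j)
  refine hasDerivAt_pi.2 fun i => ?_
  fin_cases i
  · exact ((hmul 1 2).sub (hmul 2 1)).congr_deriv (by simp [cross_apply]; ring)
  · exact ((hmul 2 0).sub (hmul 0 2)).congr_deriv (by simp [cross_apply]; ring)
  · exact ((hmul 0 1).sub (hmul 1 0)).congr_deriv (by simp [cross_apply]; ring)

theorem hasDerivAt_ofLp {n : ℕ} {f : ℝ → EuclideanSpace ℝ (Fin n)}
    {f' : EuclideanSpace ℝ (Fin n)} {t : ℝ} (hf : HasDerivAt f f' t) :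
    HasDerivAt (fun s => (f s).ofLp) f'.ofLp t :=
  (PiLp.hasFDerivAt_ofLp 2 (f t)).comp_hasDerivAt t hf

theorem hasDerivAt_toLp {n : ℕ} {f : ℝ → Fin n → ℝ} {f' : Fin n → ℝ} {t : ℝ}
    (hf : HasDerivAt f f' t) :
    HasDerivAt (fun s => (WithLp.toLp 2 (f s) : EuclideanSpace ℝ (Fin n))) (WithLp.toLp 2 f') t :=
  (PiLp.hasFDerivAt_toLp 2 (f t)).comp_hasDerivAt t hf

theorem hasDerivAt_cross {p q : ℝ → E3} {p' q' : E3} {t : ℝ} (hp : HasDerivAt p p' t)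
    (hq : HasDerivAt q q' t) :
    HasDerivAt (fun s => cross (p s) (q s)) (cross p' (q t) + cross (p t) q') t :=
  hasDerivAt_toLp (hasDerivAt_crossProduct (hasDerivAt_ofLp hp) (hasDerivAt_ofLp hq))

theorem hasDerivAt_of_contDiffOn {F : Type*} [NormedAddCommGroup F] [NormedSpace ℝ F] {f : ℝ → F}
    {I : Set ℝ} (hI : IsOpen I) (hf : ContDiffOn ℝ ∞ f I) {s : ℝ} (hs : s ∈ I) :
    HasDerivAt f (deriv f s) s :=
  ((hf.differentiableOn (by simp)).differentiableAt (hI.mem_nhds hs)).hasDerivAt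

theorem hasDerivAt_deriv_of_contDiffOn {F : Type*} [NormedAddCommGroup F] [NormedSpace ℝ F]
    {f : ℝ → F} {I : Set ℝ} (hI : IsOpen I) (hf : ContDiffOn ℝ ∞ f I) {s : ℝ} (hs : s ∈ I) :
    HasDerivAt (deriv f) (deriv (deriv f) s) s :=
  hasDerivAt_of_contDiffOn hI ((contDiffOn_infty_iff_deriv_of_isOpen hI).1 hf).2 hs

theorem eq_of_hasDerivAt_eq_zero {F : Type*} [NormedAddCommGroup F] [NormedSpace ℝ F] {f : ℝ → F}
    {I : Set ℝ} (hI : IsOpen I) (hconn : I.OrdConnected) (hf : ∀ t ∈ I, HasDerivAt f 0 t)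
    {s t : ℝ} (hs : s ∈ I) (ht : t ∈ I) : f s = f t :=
  hI.is_const_of_deriv_eq_zero hconn.isPreconnected
    (fun x hx => (hf x hx).differentiableAt.differentiableWithinAt) (fun x hx => (hf x hx).deriv)
    hs ht

theorem inner_add_inner_eq_zero_of_eventually_const {E : Type*} [NormedAddCommGroup E]
    [InnerProductSpace ℝ E] {f g : ℝ → E} {f' g' : E} {t k : ℝ} (hf : HasDerivAt f f' t)
    (hg : HasDerivAt g g' t) (h : ∀ᶠ s in nhds t, inner ℝ (f s) (g s) = k) :
    inner ℝ (f t) g' + inner ℝ f' (g t) = 0 :=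
  (hf.inner ℝ hg).unique ((hasDerivAt_const t k).congr_of_eventuallyEq h)

end Derivatives

section EulerLagrange

theorem inner_eq_sum_three (x y : E3) : inner ℝ x y = x 0 * y 0 + x 1 * y 1 + x 2 * y 2 := by
  simp only [PiLp.inner_apply, Fin.sum_univ_three, RCLike.inner_apply, conj_trivial]
  ring

theorem inner_eq_dotProduct (x y : E3) : inner ℝ x y = x.ofLp ⬝ᵥ y.ofLp := by
  rw [inner_eq_sum_three, dotProduct, Fin.sum_univ_three]

theorem inner_cross_left_self (x y : E3) : inner ℝ (cross x y) x = 0 := by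
  rw [inner_eq_dotProduct, dotProduct_comm]; exact dot_self_cross _ _

theorem inner_cross_right_self (x y : E3) : inner ℝ (cross x y) y = 0 := by
  rw [inner_eq_dotProduct, dotProduct_comm]; exact dot_cross_self _ _

theorem inner_cross_self (p q : E3) : inner ℝ (cross p q) (cross p q) =
    inner ℝ p p * inner ℝ q q - inner ℝ p q ^ 2 := by
  simp only [inner_eq_dotProduct, cross, cross_dot_cross]
  rw [dotProduct_comm q.ofLp p.ofLp, sq]

/-- The Weingarten equations along a curve in the surface. -/
theorem exists_hasDerivAt_normalized_cross {p q : ℝ → E3} {p' q' : E3} {t : ℝ}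
    (hp : HasDerivAt p p' t) (hq : HasDerivAt q q' t) (hne : cross (p t) (q t) ≠ 0)
    {ν : ℝ → E3} (hν : ∀ s, ν s = ‖cross (p s) (q s)‖⁻¹ • cross (p s) (q s)) :
    ∃ ν' : E3, HasDerivAt ν ν' t ∧ inner ℝ (ν t) ν' = 0 ∧ inner ℝ ν' (p t) = -inner ℝ (ν t) p' ∧
      inner ℝ ν' (q t) = -inner ℝ (ν t) q' := by
  have hN := hasDerivAt_cross hp hq
  have hdiff : DifferentiableAt ℝ ν t := by
    rw [funext hν]
    exact ((hN.differentiableAt.norm ℝ hne).inv (norm_ne_zero_iff.2 hne)).smul hN.differentiableAt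
  have hunit : ∀ᶠ s in nhds t, inner ℝ (ν s) (ν s) = (1 : ℝ) := by
    filter_upwards [hN.continuousAt.eventually_ne hne] with s hs
    rw [hν, real_inner_self_eq_norm_sq, norm_smul, norm_inv, norm_norm,
      inv_mul_cancel₀ (norm_ne_zero_iff.2 hs), one_pow]
  have hνp (s : ℝ) : inner ℝ (ν s) (p s) = (0 : ℝ) := by
    rw [hν, real_inner_smul_left, inner_cross_left_self, mul_zero]
  have hνq (s : ℝ) : inner ℝ (ν s) (q s) = (0 : ℝ) := by
    rw [hν, real_inner_smul_left, inner_cross_right_self, mul_zero]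
  have hν' := hdiff.hasDerivAt
  have hdunit := inner_add_inner_eq_zero_of_eventually_const hν' hν' hunit
  have hdp := inner_add_inner_eq_zero_of_eventually_const hν' hp (.of_forall hνp)
  have hdq := inner_add_inner_eq_zero_of_eventually_const hν' hq (.of_forall hνq)
  rw [real_inner_comm (ν t)] at hdunit
  exact ⟨_, hν', by linarith, by linarith, by linarith⟩

theorem hasGradientAt_dirichletDensity {ν : E3} (hν : ν 2 ≠ 0) :
    HasGradientAt dirichletDensity ((-(ν 2 ^ 2)⁻¹ - 1) • EuclideanSpace.single 2 1) ν := by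
  have hdensity : HasDerivAt (fun y : ℝ => 1 / y - y) (-(ν 2 ^ 2)⁻¹ - 1) (ν 2) := by
    simp only [one_div]
    exact (hasDerivAt_inv hν).fun_sub (hasDerivAt_id' (ν 2))
  have hheight : HasFDerivAt (fun x : E3 => x 2) (EuclideanSpace.proj (𝕜 := ℝ) 2) ν :=
    PiLp.hasFDerivAt_apply 2 ν 2
  rw [hasGradientAt_iff_hasFDerivAt]
  refine (hdensity.comp_hasFDerivAt ν hheight).congr_fderiv ?_
  ext x
  simp [EuclideanSpace.inner_single_left]

theorem sphereGradient_dirichletDensity {ν : E3} (hν : ν 2 ≠ 0) :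
    sphereGradient dirichletDensity ν =
      (-(ν 2 ^ 2)⁻¹ - 1) • (EuclideanSpace.single 2 1 - ν 2 • ν) := by
  rw [sphereGradient, (hasGradientAt_dirichletDensity hν).gradient, real_inner_smul_left,
    EuclideanSpace.inner_single_left, smul_sub, smul_smul]
  simp

theorem exists_hasDerivAt_sphereGradient {ν : ℝ → E3} {ν' : E3} {t : ℝ} (hν : HasDerivAt ν ν' t)
    (hν₃ : ν t 2 ≠ 0) :
    ∃ V' : E3, HasDerivAt (fun s => sphereGradient dirichletDensity (ν s)) V' t ∧
      ∀ x, inner ℝ (ν t) x = (0 : ℝ) → inner ℝ V' x =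
        2 / ν t 2 ^ 3 * (ν' 2 * x 2) + (1 / ν t 2 + ν t 2) * inner ℝ ν' x := by
  have hheight : HasDerivAt (fun s => ν s 2) (ν' 2) t := hasDerivAt_pi.1 (hasDerivAt_ofLp hν) 2
  have hfactor := ((hheight.fun_pow 2).fun_inv (pow_ne_zero 2 hν₃)).fun_neg.sub_const 1
  have hV := hfactor.fun_smul ((hheight.fun_smul hν).const_sub (EuclideanSpace.single 2 1))
  refine ⟨_, hV.congr_of_eventuallyEq ?_, fun x hx => ?_⟩
  · filter_upwards [hheight.continuousAt.eventually_ne hν₃] with s hs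
    exact sphereGradient_dirichletDensity hs
  · simp only [inner_add_left, inner_sub_left, inner_neg_left, real_inner_smul_left, hx,
      EuclideanSpace.inner_single_left, map_one, Nat.cast_ofNat]
    field_simp
    ring

/-- The vectors `a`, `b`, `d` are the second partial derivatives `X_ss`, `X_sθ = X_θs`, `X_θθ` of
`X` at `(s, θ)`. -/
structure HasSecondPartialsAt (X : ℝ → ℝ → E3) (a b d : E3) (s θ : ℝ) : Prop where
  ss : HasDerivAt (fun t => partialS X t θ) a s
  st : HasDerivAt (fun t => partialS X s t) b θ
  ts : HasDerivAt (fun t => partialT X t θ) b s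
  tt : HasDerivAt (fun t => partialT X s t) d θ

theorem inner_unitNormal_partialS (X : ℝ → ℝ → E3) (s θ : ℝ) :
    inner ℝ (unitNormal X s θ) (partialS X s θ) = 0 := by
  rw [unitNormal, normalVec, real_inner_smul_left, inner_cross_left_self, mul_zero]

theorem inner_unitNormal_partialT (X : ℝ → ℝ → E3) (s θ : ℝ) :
    inner ℝ (unitNormal X s θ) (partialT X s θ) = 0 := by
  rw [unitNormal, normalVec, real_inner_smul_left, inner_cross_right_self, mul_zero]

theorem anisotropicMeanCurvature_dirichletDensity {X : ℝ → ℝ → E3} {a b d ν νs νt : E3} {s θ : ℝ}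
    (hX : HasSecondPartialsAt X a b d s θ) (hν : unitNormal X s θ = ν)
    (hνs : HasDerivAt (fun t => unitNormal X t θ) νs s)
    (hνt : HasDerivAt (fun t => unitNormal X s t) νt θ) (hν₃ : ν 2 ≠ 0)
    (hss : inner ℝ νs (partialS X s θ) = -inner ℝ ν a)
    (hst : inner ℝ νs (partialT X s θ) = -inner ℝ ν b)
    (hts : inner ℝ νt (partialS X s θ) = -inner ℝ ν b)
    (htt : inner ℝ νt (partialT X s θ) = -inner ℝ ν d) :
    anisotropicMeanCurvature dirichletDensity X s θ =
      2 / ν 2 * metricTrace X s θ (inner ℝ ν a) (inner ℝ ν b) (inner ℝ ν b) (inner ℝ ν d)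
        - 2 / ν 2 ^ 3 * metricTrace X s θ (νs 2 * partialS X s θ 2) (νs 2 * partialT X s θ 2)
            (νt 2 * partialS X s θ 2) (νt 2 * partialT X s θ 2) := by
  subst hν
  obtain ⟨Vs, hVs, hVs_inner⟩ := exists_hasDerivAt_sphereGradient hνs hν₃
  obtain ⟨Vt, hVt, hVt_inner⟩ := exists_hasDerivAt_sphereGradient hνt hν₃
  have hp := inner_unitNormal_partialS X s θ
  have hq := inner_unitNormal_partialT X s θ
  have hpartials : partialS (partialS X) s θ = a ∧ partialT (partialS X) s θ = b ∧
      partialS (partialT X) s θ = b ∧ partialT (partialT X) s θ = d :=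
    ⟨hX.ss.deriv, hX.st.deriv, hX.ts.deriv, hX.tt.deriv⟩
  have hdiv : surfaceDiv X (fun s' θ' => sphereGradient dirichletDensity (unitNormal X s' θ')) s θ =
      metricTrace X s θ (inner ℝ Vs (partialS X s θ)) (inner ℝ Vs (partialT X s θ))
        (inner ℝ Vt (partialS X s θ)) (inner ℝ Vt (partialT X s θ)) := by
    rw [← hVs.deriv, ← hVt.deriv]; rfl
  rw [anisotropicMeanCurvature, hdiv, meanCurvature, hpartials.1, hpartials.2.1,
    hpartials.2.2.1, hpartials.2.2.2, hVs_inner _ hp, hVs_inner _ hq, hVt_inner _ hp,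
    hVt_inner _ hq, hss, hst, hts, htt]
  simp only [metricTrace, dirichletDensity]
  ring

/-- Cramer's rule for the components of `a` in the basis `p, q`. -/
theorem gram_mul_height_of_orthogonal {p q a : E3} (h : inner ℝ (cross p q) a = 0) :
    (inner ℝ p p * inner ℝ q q - inner ℝ p q ^ 2) * a 2 =
      p 2 * (inner ℝ q q * inner ℝ a p - inner ℝ p q * inner ℝ a q)
        + q 2 * (inner ℝ p p * inner ℝ a q - inner ℝ p q * inner ℝ a p) := by
  rw [inner_eq_dotProduct, cross, cross_dotProduct] at h
  simp only [inner_eq_sum_three]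
  linear_combination (p 0 * q 1 - p 1 * q 0) * h

theorem cross_height_sq (p q : E3) :
    cross p q 2 ^ 2 =
      (inner ℝ q q - q 2 ^ 2) * (inner ℝ p p - p 2 ^ 2) - (inner ℝ p q - p 2 * q 2) ^ 2 := by
  have hheight : cross p q 2 = p 0 * q 1 - p 1 * q 0 := by simp [cross, cross_apply]
  rw [hheight]
  simp only [inner_eq_sum_three]
  ring

theorem laplaceDefect_eq_inner (p q a b d : E3) :
    laplaceDefect p q a b d =
      (inner ℝ q q - q 2 ^ 2) * inner ℝ (cross p q) a
        - 2 * (inner ℝ p q - p 2 * q 2) * inner ℝ (cross p q) b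
        + (inner ℝ p p - p 2 ^ 2) * inner ℝ (cross p q) d := by
  have htriple (x : E3) : inner ℝ (cross p q) x = p.ofLp ⨯₃ q.ofLp ⬝ᵥ x.ofLp :=
    inner_eq_dotProduct _ _
  simp only [laplaceDefect, htriple, inner_eq_sum_three]
  ring

/-- The left side is the trace that `anisotropicMeanCurvature_dirichletDensity` produces from the
first fundamental form `E, F, G`, the second fundamental form `h`, the heights `x`, `y` of the
tangent vectors and the heights `α`, `β` of the derivatives of the normal. -/
theorem trace_sub_height_trace {E F G h₁₁ h₁₂ h₂₂ x y α β ν₃ : ℝ} (hΔ : E * G - F ^ 2 ≠ 0)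
    (hα : (E * G - F ^ 2) * α = x * (G * -h₁₁ - F * -h₁₂) + y * (E * -h₁₂ - F * -h₁₁))
    (hβ : (E * G - F ^ 2) * β = x * (G * -h₁₂ - F * -h₂₂) + y * (E * -h₂₂ - F * -h₁₂))
    (hν₃ : (E * G - F ^ 2) * ν₃ ^ 2 = (G - y ^ 2) * (E - x ^ 2) - (F - x * y) ^ 2) :
    (G * h₁₁ - F * h₁₂ - F * h₁₂ + E * h₂₂) * ν₃ ^ 2
        - (G * (α * x) - F * (α * y) - F * (β * x) + E * (β * y)) =
      (G - y ^ 2) * h₁₁ - 2 * (F - x * y) * h₁₂ + (E - x ^ 2) * h₂₂ := by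
  refine mul_left_cancel₀ hΔ ?_
  linear_combination (G * h₁₁ - 2 * F * h₁₂ + E * h₂₂) * hν₃ - (G * x - F * y) * hα
    - (E * y - F * x) * hβ

theorem anisotropicMeanCurvature_eq_laplaceDefect {X : ℝ → ℝ → E3} {a b d : E3} {s θ : ℝ}
    (hX : HasSecondPartialsAt X a b d s θ) (hN : normalVec X s θ 2 ≠ 0) :
    anisotropicMeanCurvature dirichletDensity X s θ =
      2 * laplaceDefect (partialS X s θ) (partialT X s θ) a b d / normalVec X s θ 2 ^ 3 := by
  have hn : ‖normalVec X s θ‖ ≠ 0 := fun h => hN (by rw [norm_eq_zero.1 h]; rfl)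
  obtain ⟨νs, hνs, hs, hss, hst⟩ := exists_hasDerivAt_normalized_cross hX.ss hX.ts
    (norm_ne_zero_iff.1 hn) (ν := fun t => unitNormal X t θ) fun _ => rfl
  obtain ⟨νt, hνt, ht, hts, htt⟩ := exists_hasDerivAt_normalized_cross hX.st hX.tt
    (norm_ne_zero_iff.1 hn) (ν := fun t => unitNormal X s t) fun _ => rfl
  have hnormal : cross (partialS X s θ) (partialT X s θ) = ‖normalVec X s θ‖ • unitNormal X s θ :=
    (smul_inv_smul₀ hn _).symm
  have hN₃ : normalVec X s θ 2 = ‖normalVec X s θ‖ * unitNormal X s θ 2 :=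
    congrArg (fun x : E3 => x 2) hnormal
  have hν₃ : unitNormal X s θ 2 ≠ 0 := right_ne_zero_of_mul (hN₃ ▸ hN)
  have hΔ : ‖normalVec X s θ‖ ^ 2 =
      inner ℝ (partialS X s θ) (partialS X s θ) * inner ℝ (partialT X s θ) (partialT X s θ)
        - inner ℝ (partialS X s θ) (partialT X s θ) ^ 2 := by
    rw [← inner_cross_self, ← real_inner_self_eq_norm_sq, normalVec]
  have hα := gram_mul_height_of_orthogonal (p := partialS X s θ) (q := partialT X s θ) (a := νs)
    (by rw [hnormal, real_inner_smul_left, hs, mul_zero])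
  have hβ := gram_mul_height_of_orthogonal (p := partialS X s θ) (q := partialT X s θ) (a := νt)
    (by rw [hnormal, real_inner_smul_left, ht, mul_zero])
  have hheight := cross_height_sq (partialS X s θ) (partialT X s θ)
  rw [hss, hst] at hα
  rw [hts, htt] at hβ
  rw [← normalVec, hN₃, mul_pow, hΔ] at hheight
  have htrace := trace_sub_height_trace (hΔ ▸ pow_ne_zero 2 hn) hα hβ hheight
  rw [anisotropicMeanCurvature_dirichletDensity hX rfl hνs hνt hν₃ hss hst hts htt,
    laplaceDefect_eq_inner, hnormal, real_inner_smul_left, real_inner_smul_left,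
    real_inner_smul_left, hN₃]
  simp only [metricTrace, ← hΔ]
  field_simp
  linear_combination htrace

theorem normalVec_height_ne_zero {X : ℝ → ℝ → E3} {U : Set (ℝ × ℝ)} {s θ : ℝ}
    (hmin : IsDirichletMinimalOn X U) (h : (s, θ) ∈ U) : normalVec X s θ 2 ≠ 0 := by
  have hν := (hmin _ h).2.1
  rw [unitNormal, PiLp.smul_apply] at hν
  exact right_ne_zero_of_smul hν

end EulerLagrange

section Planes

theorem coplanar_of_inner_eq_const {E : Type*} [NormedAddCommGroup E] [InnerProductSpace ℝ E]
    (hE : Module.finrank ℝ E = 3) {n : E} (hn : n ≠ 0) {S : Set E} {k : ℝ}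
    (h : ∀ x ∈ S, inner ℝ n x = k) : Coplanar ℝ S := by
  have : Fact (Module.finrank ℝ E = 2 + 1) := ⟨hE⟩
  have : FiniteDimensional ℝ E := .of_fact_finrank_eq_succ 2
  have hle : vectorSpan ℝ S ≤ (Submodule.span ℝ {n})ᗮ := by
    rw [vectorSpan_def, Submodule.span_le]
    rintro _ ⟨x, hx, y, hy, rfl⟩
    simp only [SetLike.mem_coe, Submodule.mem_orthogonal_singleton_iff_inner_right, vsub_eq_sub,
      inner_sub_right, h x hx, h y hy, sub_self]
  have hrank := Submodule.rank_mono hle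
  rw [← Module.finrank_eq_rank ℝ (Submodule.span ℝ {n})ᗮ,
    Submodule.finrank_orthogonal_span_singleton (n := 2) hn] at hrank
  exact_mod_cast hrank

theorem mem_direction_xyPlane {x : E3} (hx : x 2 = 0) : x ∈ xyPlane.direction := by
  rw [xyPlane, AffineSubspace.direction_mk', Submodule.mem_span_pair]
  refine ⟨x 0, x 1, ?_⟩
  ext i
  fin_cases i <;> simp [hx]

theorem finrank_direction_xyPlane_le : Module.finrank ℝ xyPlane.direction ≤ 2 := by
  classical
  rw [xyPlane, AffineSubspace.direction_mk']
  refine (finrank_span_le_card _).trans ?_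
  rw [Set.toFinset_insert, Set.toFinset_singleton]
  exact Finset.card_le_two

theorem finrank_span_pair_of_orthonormal {E : Type*} [NormedAddCommGroup E]
    [InnerProductSpace ℝ E] {x y : E} (h : Orthonormal ℝ ![x, y]) :
    Module.finrank ℝ (Submodule.span ℝ {x, y}) = 2 := by
  rw [← Matrix.range_cons_cons_empty x y ![], finrank_span_eq_card h.linearIndependent,
    Fintype.card_fin]

theorem mk'_span_pair_parallel_xyPlane {x y : E3} (p : E3) (h : Orthonormal ℝ ![x, y])
    (hx : x 2 = 0) (hy : y 2 = 0) :
    (AffineSubspace.mk' p (Submodule.span ℝ {x, y})).Parallel xyPlane := by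
  have hle : Submodule.span ℝ {x, y} ≤ xyPlane.direction :=
    Submodule.span_le.2 (Set.pair_subset (mem_direction_xyPlane hx) (mem_direction_xyPlane hy))
  have heq := Submodule.eq_of_le_of_finrank_le hle
    (finrank_direction_xyPlane_le.trans_eq (finrank_span_pair_of_orthonormal h).symm)
  have hne : xyPlane ≠ ⊥ :=
    (AffineSubspace.nonempty_iff_ne_bot _).1 (AffineSubspace.mk'_nonempty _ _)
  rw [AffineSubspace.parallel_iff_direction_eq_and_eq_bot_iff_eq_bot,
    AffineSubspace.direction_mk', iff_false_right hne, ← Ne, ← AffineSubspace.nonempty_iff_ne_bot]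
  exact ⟨heq, AffineSubspace.mk'_nonempty _ _⟩

end Planes

namespace CircleFamily

open Complex Filter Topology

variable (C : CircleFamily)

/-- The complex vector `r (u + i v)` that encodes the radius and the plane of the circle of
parameter `s`, so that the circle is `c + ellipsePoint θ (r (u + i v))`. -/
noncomputable def radial (s : ℝ) : Fin 3 → ℂ := fun i => C.r s * (C.u s i + C.v s i * Complex.I)

variable {C} {s θ : ℝ}

theorem param_eq_ellipsePoint (s θ : ℝ) :
    C.param s θ = C.c s + WithLp.toLp 2 (ellipsePoint θ (C.radial s)) := by
  rw [param]
  congr 1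
  ext i
  have hre : (C.radial s i).re = C.r s * C.u s i := by simp [radial]
  have him : (C.radial s i).im = C.r s * C.v s i := by simp [radial]
  simp only [PiLp.smul_apply, PiLp.add_apply, smul_eq_mul, ellipsePoint_apply, hre, him]
  ring

theorem inner_u_u (hs : s ∈ C.I) : inner ℝ (C.u s) (C.u s) = 1 := by
  rw [real_inner_self_eq_norm_sq, C.norm_u s hs, one_pow]

theorem inner_v_v (hs : s ∈ C.I) : inner ℝ (C.v s) (C.v s) = 1 := by
  rw [real_inner_self_eq_norm_sq, C.norm_v s hs, one_pow]

theorem radial_dotProduct_self (hs : s ∈ C.I) : C.radial s ⬝ᵥ C.radial s = 0 := by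
  have huu := inner_u_u hs
  have hvv := inner_v_v hs
  have huv := C.inner_u_v s hs
  rw [inner_eq_sum_three, ← ofReal_inj] at huu hvv huv
  push_cast at huu hvv huv
  simp only [dotProduct, Fin.sum_univ_three, radial]
  linear_combination (C.r s : ℂ) ^ 2 * (huu - hvv + 2 * Complex.I * huv
    + (C.v s 0 ^ 2 + C.v s 1 ^ 2 + C.v s 2 ^ 2 : ℂ) * I_sq)

theorem contDiffOn_radial : ContDiffOn ℝ ∞ C.radial C.I := by
  have hr : ContDiffOn ℝ ∞ (fun s => (C.r s : ℂ)) C.I :=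
    ofRealCLM.contDiff.comp_contDiffOn C.smooth_r
  have hu (i : Fin 3) : ContDiffOn ℝ ∞ (fun s => (C.u s i : ℂ)) C.I :=
    ofRealCLM.contDiff.comp_contDiffOn (contDiffOn_euclidean.1 C.smooth_u i)
  have hv (i : Fin 3) : ContDiffOn ℝ ∞ (fun s => (C.v s i : ℂ)) C.I :=
    ofRealCLM.contDiff.comp_contDiffOn (contDiffOn_euclidean.1 C.smooth_v i)
  exact contDiffOn_pi.2 fun i => hr.mul ((hu i).add ((hv i).mul contDiffOn_const))

theorem hasDerivAt_c (hs : s ∈ C.I) : HasDerivAt C.c (deriv C.c s) s :=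
  hasDerivAt_of_contDiffOn C.isOpen_I C.smooth_c hs

theorem hasDerivAt_r (hs : s ∈ C.I) : HasDerivAt C.r (deriv C.r s) s :=
  hasDerivAt_of_contDiffOn C.isOpen_I C.smooth_r hs

theorem hasDerivAt_u (hs : s ∈ C.I) : HasDerivAt C.u (deriv C.u s) s :=
  hasDerivAt_of_contDiffOn C.isOpen_I C.smooth_u hs

theorem hasDerivAt_v (hs : s ∈ C.I) : HasDerivAt C.v (deriv C.v s) s :=
  hasDerivAt_of_contDiffOn C.isOpen_I C.smooth_v hs

theorem hasDerivAt_radial (hs : s ∈ C.I) : HasDerivAt C.radial (deriv C.radial s) s :=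
  hasDerivAt_of_contDiffOn C.isOpen_I contDiffOn_radial hs

theorem hasDerivAt_deriv_radial (hs : s ∈ C.I) :
    HasDerivAt (deriv C.radial) (deriv (deriv C.radial) s) s :=
  hasDerivAt_deriv_of_contDiffOn C.isOpen_I contDiffOn_radial hs

theorem partialS_param (hs : s ∈ C.I) (θ : ℝ) :
    partialS C.param s θ =
      deriv C.c s + WithLp.toLp 2 (ellipsePoint θ (deriv C.radial s)) := by
  simp only [partialS, param_eq_ellipsePoint]
  exact ((hasDerivAt_c hs).add
    (hasDerivAt_toLp (hasDerivAt_ellipsePoint (hasDerivAt_radial hs) θ))).deriv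

theorem partialT_param (s θ : ℝ) :
    partialT C.param s θ = WithLp.toLp 2 (ellipsePoint θ (-Complex.I • C.radial s)) := by
  simp only [partialT, param_eq_ellipsePoint]
  exact ((hasDerivAt_toLp (hasDerivAt_ellipsePoint_angle (C.radial s) θ)).const_add (C.c s)).deriv

theorem hasSecondPartialsAt_param (hs : s ∈ C.I) (θ : ℝ) :
    HasSecondPartialsAt C.param
      (deriv (deriv C.c) s + WithLp.toLp 2 (ellipsePoint θ (deriv (deriv C.radial) s)))
      (WithLp.toLp 2 (ellipsePoint θ (-Complex.I • deriv C.radial s)))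
      (WithLp.toLp 2 (ellipsePoint θ (-C.radial s))) s θ where
  ss := by
    refine HasDerivAt.congr_of_eventuallyEq ?_ (eventually_of_mem (C.isOpen_I.mem_nhds hs)
      fun _ ht => partialS_param ht θ)
    exact (hasDerivAt_deriv_of_contDiffOn C.isOpen_I C.smooth_c hs).add
      (hasDerivAt_toLp (hasDerivAt_ellipsePoint (hasDerivAt_deriv_radial hs) θ))
  st := by
    simp only [partialS_param hs]
    exact (hasDerivAt_toLp (hasDerivAt_ellipsePoint_angle _ θ)).const_add _
  ts := by
    simp only [partialT_param]
    exact hasDerivAt_toLp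
      (hasDerivAt_ellipsePoint ((hasDerivAt_radial hs).const_smul (-Complex.I)) θ)
  tt := by
    have hsq : -Complex.I • -Complex.I • C.radial s = -C.radial s := by
      rw [smul_smul, neg_mul_neg, Complex.I_mul_I, neg_one_smul]
    simp only [partialT_param, ← hsq]
    exact hasDerivAt_toLp (hasDerivAt_ellipsePoint_angle _ θ)

theorem radial_dotProduct_deriv (hs : s ∈ C.I) : C.radial s ⬝ᵥ deriv C.radial s = 0 := by
  have hderiv := hasDerivAt_dotProduct (hasDerivAt_radial hs) (hasDerivAt_radial hs)
  have hconst := (hasDerivAt_const s (0 : ℂ)).congr_of_eventuallyEq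
    (eventually_of_mem (C.isOpen_I.mem_nhds hs) fun _ ht => radial_dotProduct_self ht)
  have hsum := hderiv.unique hconst
  rw [dotProduct_comm (deriv C.radial s), ← two_mul] at hsum
  exact (mul_eq_zero.1 hsum).resolve_left two_ne_zero

theorem deriv_radial_dotProduct_self_add (hs : s ∈ C.I) :
    deriv C.radial s ⬝ᵥ deriv C.radial s + C.radial s ⬝ᵥ deriv (deriv C.radial) s = 0 :=
  (hasDerivAt_dotProduct (hasDerivAt_radial hs) (hasDerivAt_deriv_radial hs)).unique
    ((hasDerivAt_const s (0 : ℂ)).congr_of_eventuallyEq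
      (eventually_of_mem (C.isOpen_I.mem_nhds hs) fun _ ht => radial_dotProduct_deriv ht))

theorem radial_two_eq_zero_iff (hs : s ∈ C.I) : C.radial s 2 = 0 ↔ C.u s 2 = 0 ∧ C.v s 2 = 0 := by
  simp [radial, (C.r_pos s hs).ne', Complex.ext_iff]

theorem re_cross_im_radial (s : ℝ) :
    (re ∘ C.radial s) ⨯₃ (im ∘ C.radial s) = C.r s ^ 2 • (cross (C.u s) (C.v s)).ofLp := by
  have hre : re ∘ C.radial s = C.r s • (C.u s).ofLp := by ext i; simp [radial]
  have him : im ∘ C.radial s = C.r s • (C.v s).ofLp := by ext i; simp [radial]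
  rw [hre, him, cross, map_smul, map_smul, LinearMap.smul_apply, smul_smul, sq]

theorem orthonormal_frame (hs : s ∈ C.I) : Orthonormal ℝ ![C.u s, C.v s] := by
  simp [C.norm_u s hs, C.norm_v s hs, C.inner_u_v s hs]

theorem plane_parallel_xyPlane (hs : s ∈ C.I) (h : C.radial s 2 = 0) :
    (C.plane s).Parallel xyPlane := by
  obtain ⟨hu, hv⟩ := (radial_two_eq_zero_iff hs).1 h
  exact mk'_span_pair_parallel_xyPlane (C.c s) (orthonormal_frame hs) hu hv

theorem cross_frame_ne_zero (hs : s ∈ C.I) : cross (C.u s) (C.v s) ≠ 0 := by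
  have hself := inner_cross_self (C.u s) (C.v s)
  rw [inner_u_u hs, inner_v_v hs, C.inner_u_v s hs] at hself
  intro hzero
  norm_num [hzero] at hself

theorem inner_cross_frame_param (s θ : ℝ) :
    inner ℝ (cross (C.u s) (C.v s)) (C.param s θ) =
      inner ℝ (cross (C.u s) (C.v s)) (C.c s) := by
  simp only [param, inner_add_right, real_inner_smul_right, inner_cross_left_self,
    inner_cross_right_self, mul_zero, add_zero]

theorem deriv_radial_apply (hs : s ∈ C.I) (i : Fin 3) :
    deriv C.radial s i = deriv C.r s * (C.u s i + C.v s i * Complex.I)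
      + C.r s * (deriv C.u s i + deriv C.v s i * Complex.I) := by
  have hu := (hasDerivAt_pi.1 (hasDerivAt_ofLp (hasDerivAt_u hs)) i).ofReal_comp
  have hv := (hasDerivAt_pi.1 (hasDerivAt_ofLp (hasDerivAt_v hs)) i).ofReal_comp
  exact (hasDerivAt_pi.1 (hasDerivAt_radial hs) i).unique
    ((hasDerivAt_r hs).ofReal_comp.mul (hu.add (hv.mul_const Complex.I)))

/-- A frame of a stationary plane only rotates in that plane. -/
theorem exists_deriv_frame_eq_rotation (hs : s ∈ C.I) {k : ℂ}
    (hk : deriv C.radial s = k • C.radial s) :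
    ∃ φ : ℝ, deriv C.u s = -φ • C.v s ∧ deriv C.v s = φ • C.u s := by
  have hr : (C.r s : ℂ) ≠ 0 := ofReal_ne_zero.2 (C.r_pos s hs).ne'
  obtain ⟨q, hq⟩ : ∃ q : ℂ, ∀ i, (deriv C.u s i + deriv C.v s i * Complex.I : ℂ) =
      q * (C.u s i + C.v s i * Complex.I) := by
    refine ⟨k - deriv C.r s / C.r s, fun i => ?_⟩
    have hki := congrFun hk i
    rw [deriv_radial_apply hs, Pi.smul_apply, smul_eq_mul, radial] at hki
    field_simp
    linear_combination hki
  have hu : deriv C.u s = q.re • C.u s - q.im • C.v s := by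
    ext i
    simpa using congrArg re (hq i)
  have hv : deriv C.v s = q.im • C.u s + q.re • C.v s := by
    ext i
    simpa [add_comm] using congrArg im (hq i)
  have hre : q.re = 0 := by
    have horth := inner_add_inner_eq_zero_of_eventually_const (hasDerivAt_u hs) (hasDerivAt_u hs)
      (eventually_of_mem (C.isOpen_I.mem_nhds hs) fun _ ht => inner_u_u ht)
    rw [real_inner_comm (C.u s) (deriv C.u s), hu, inner_sub_right, real_inner_smul_right,
      real_inner_smul_right, inner_u_u hs, C.inner_u_v s hs] at horth
    linarith
  exact ⟨q.im, by rw [hu, hre]; module, by rw [hv, hre]; module⟩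

theorem normalVec_param_height (hs : s ∈ C.I) (θ : ℝ) :
    normalVec C.param s θ 2 = (((deriv C.c s).ofLp + ellipsePoint θ (deriv C.radial s)) ⨯₃
      ellipsePoint θ (-Complex.I • C.radial s)) 2 := by
  simp only [normalVec, cross, partialS_param hs, partialT_param, WithLp.ofLp_add]

section Minimal

variable {U : Set (ℝ × ℝ)}

theorem sweptLaplaceDefect_radial_eq_zero (hU : C.IsDomain U)
    (hmin : IsDirichletMinimalOn C.param U) (h : (s, θ) ∈ U) :
    sweptLaplaceDefect (deriv C.c s).ofLp (deriv (deriv C.c) s).ofLp (C.radial s)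
      (deriv C.radial s) (deriv (deriv C.radial) s) θ = 0 := by
  have hs := hU.2.1 _ h
  have hheight := normalVec_height_ne_zero hmin h
  have hΛ := (hmin _ h).2.2
  rw [anisotropicMeanCurvature_eq_laplaceDefect (hasSecondPartialsAt_param hs θ) hheight,
    div_eq_zero_iff, or_iff_left (pow_ne_zero 3 hheight), partialS_param hs,
    partialT_param] at hΛ
  exact (mul_eq_zero.1 hΛ).resolve_left two_ne_zero

theorem exists_eventually_sweptLaplaceDefect_radial_eq_zero (hU : C.IsDomain U)
    (hmin : IsDirichletMinimalOn C.param U) (hs : s ∈ C.I) :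
    ∃ θ₀, (s, θ₀) ∈ U ∧ ∀ᶠ θ in 𝓝 θ₀,
      sweptLaplaceDefect (deriv C.c s).ofLp (deriv (deriv C.c) s).ofLp (C.radial s)
        (deriv C.radial s) (deriv (deriv C.radial) s) θ = 0 := by
  obtain ⟨θ₀, hθ₀⟩ := hU.2.2 s hs
  have hnear : ∀ᶠ θ in 𝓝 θ₀, (s, θ) ∈ U :=
    (Continuous.prodMk_right s).continuousAt.eventually_mem (hU.1.mem_nhds hθ₀)
  exact ⟨θ₀, hθ₀, hnear.mono fun θ hθ => sweptLaplaceDefect_radial_eq_zero hU hmin hθ⟩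

theorem radial_cross_deriv_radial (hU : C.IsDomain U)
    (hmin : IsDirichletMinimalOn C.param U) (hs : s ∈ C.I) (hne : C.radial s 2 ≠ 0) :
    C.radial s ⨯₃ deriv C.radial s = 0 := by
  obtain ⟨θ₀, -, hzero⟩ := exists_eventually_sweptLaplaceDefect_radial_eq_zero hU hmin hs
  exact crossProduct_eq_zero_of_sweptLaplaceDefect_eq_zero (radial_dotProduct_self hs)
    (radial_dotProduct_deriv hs) (deriv_radial_dotProduct_self_add hs) hne hzero

theorem radial_cross_deriv_deriv_radial (hU : C.IsDomain U)
    (hmin : IsDirichletMinimalOn C.param U) (hs : s ∈ C.I) (hne : C.radial s 2 ≠ 0) :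
    C.radial s ⨯₃ deriv (deriv C.radial) s = 0 := by
  have hne_near : ∀ᶠ t in 𝓝 s, C.radial t 2 ≠ 0 :=
    (hasDerivAt_pi.1 (hasDerivAt_radial hs) 2).continuousAt.eventually_ne hne
  have hconst : ∀ᶠ t in 𝓝 s, C.radial t ⨯₃ deriv C.radial t = 0 := by
    filter_upwards [hne_near, C.isOpen_I.mem_nhds hs] with t hnet ht
    exact radial_cross_deriv_radial hU hmin ht hnet
  have hderiv := hasDerivAt_crossProduct (hasDerivAt_radial hs) (hasDerivAt_deriv_radial hs)
  rw [cross_self, zero_add] at hderiv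
  exact hderiv.unique ((hasDerivAt_const s 0).congr_of_eventuallyEq hconst)

theorem exists_deriv_radial_eq_smul (hU : C.IsDomain U)
    (hmin : IsDirichletMinimalOn C.param U) (hs : s ∈ C.I) (hne : C.radial s 2 ≠ 0) :
    ∃ k l : ℂ, deriv C.radial s = k • C.radial s ∧
      deriv (deriv C.radial) s = l • C.radial s := by
  have hne' : C.radial s ≠ 0 := fun h => hne (congrFun h 2)
  obtain ⟨k, hk⟩ := exists_eq_smul_of_crossProduct_eq_zero hne'
    (radial_cross_deriv_radial hU hmin hs hne)
  obtain ⟨l, hl⟩ := exists_eq_smul_of_crossProduct_eq_zero hne'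
    (radial_cross_deriv_deriv_radial hU hmin hs hne)
  exact ⟨k, l, hk, hl⟩

theorem inner_cross_frame_deriv_c (hU : C.IsDomain U)
    (hmin : IsDirichletMinimalOn C.param U) (hs : s ∈ C.I) (hne : C.radial s 2 ≠ 0) :
    inner ℝ (cross (C.u s) (C.v s)) (deriv C.c s) = 0 := by
  obtain ⟨k, l, hk, hl⟩ := exists_deriv_radial_eq_smul hU hmin hs hne
  obtain ⟨θ₀, hθ₀, hnear⟩ := exists_eventually_sweptLaplaceDefect_radial_eq_zero hU hmin hs
  have hzero := sweptLaplaceDefect_eq_zero hnear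
  have hheight := normalVec_height_ne_zero hmin hθ₀
  rw [normalVec_param_height hs, hk] at hheight
  rw [hk, hl] at hzero
  have htangent := center_tangent_of_sweptLaplaceDefect_eq_zero (radial_dotProduct_self hs) hne
    hzero hheight
  rw [re_cross_im_radial, smul_dotProduct, ← inner_eq_dotProduct] at htangent
  exact (smul_eq_zero.1 htangent).resolve_left (pow_ne_zero 2 (C.r_pos s hs).ne')

theorem exists_deriv_frame_eq_rotation_of_minimal (hU : C.IsDomain U)
    (hmin : IsDirichletMinimalOn C.param U) (hs : s ∈ C.I) (hne : C.radial s 2 ≠ 0) :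
    ∃ φ : ℝ, deriv C.u s = -φ • C.v s ∧ deriv C.v s = φ • C.u s := by
  obtain ⟨k, -, hk, -⟩ := exists_deriv_radial_eq_smul hU hmin hs hne
  exact exists_deriv_frame_eq_rotation hs hk

theorem hasDerivAt_cross_frame (hU : C.IsDomain U)
    (hmin : IsDirichletMinimalOn C.param U) (hs : s ∈ C.I) (hne : C.radial s 2 ≠ 0) :
    HasDerivAt (fun t => cross (C.u t) (C.v t)) 0 s := by
  obtain ⟨φ, hu, hv⟩ := exists_deriv_frame_eq_rotation_of_minimal hU hmin hs hne
  refine (hasDerivAt_cross (hasDerivAt_u hs) (hasDerivAt_v hs)).congr_deriv ?_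
  simp [hu, hv, cross]

theorem hasDerivAt_inner_cross_frame_c (hU : C.IsDomain U)
    (hmin : IsDirichletMinimalOn C.param U) (hs : s ∈ C.I) (hne : C.radial s 2 ≠ 0) :
    HasDerivAt (fun t => inner ℝ (cross (C.u t) (C.v t)) (C.c t)) (0 : ℝ) s := by
  refine ((hasDerivAt_cross_frame hU hmin hs hne).inner ℝ (hasDerivAt_c hs)).congr_deriv ?_
  rw [inner_cross_frame_deriv_c hU hmin hs hne, inner_zero_left, add_zero]

/-- `u₃² + v₃²` is the squared sine of the angle between the plane of the circle and the
`xy`-plane. -/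
theorem hasDerivAt_inclination (hU : C.IsDomain U)
    (hmin : IsDirichletMinimalOn C.param U) (hs : s ∈ C.I) :
    HasDerivAt (fun t => C.u t 2 ^ 2 + C.v t 2 ^ 2) 0 s := by
  have hu := hasDerivAt_pi.1 (hasDerivAt_ofLp (hasDerivAt_u hs)) 2
  have hv := hasDerivAt_pi.1 (hasDerivAt_ofLp (hasDerivAt_v hs)) 2
  refine ((hu.pow 2).add (hv.pow 2)).congr_deriv ?_
  by_cases hne : C.radial s 2 = 0
  · obtain ⟨hu₀, hv₀⟩ := (radial_two_eq_zero_iff hs).1 hne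
    simp [hu₀, hv₀]
  · obtain ⟨φ, hu', hv'⟩ := exists_deriv_frame_eq_rotation_of_minimal hU hmin hs hne
    simp only [hu', hv', PiLp.smul_apply, smul_eq_mul]
    ring

theorem radial_two_ne_zero_of_ne_zero (hU : C.IsDomain U)
    (hmin : IsDirichletMinimalOn C.param U) {t : ℝ} (hs : s ∈ C.I) (ht : t ∈ C.I)
    (hne : C.radial s 2 ≠ 0) : C.radial t 2 ≠ 0 := by
  have hinc := eq_of_hasDerivAt_eq_zero C.isOpen_I C.ordConnected_I
    (fun x hx => hasDerivAt_inclination hU hmin hx) hs ht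
  rw [Ne, radial_two_eq_zero_iff hs] at hne
  rw [Ne, radial_two_eq_zero_iff ht]
  rintro ⟨hu, hv⟩
  simp only [hu, hv] at hinc
  exact hne ⟨by nlinarith, by nlinarith⟩

theorem coplanar_surface_of_radial_two_ne_zero (hU : C.IsDomain U)
    (hmin : IsDirichletMinimalOn C.param U) (hs : s ∈ C.I) (hne : C.radial s 2 ≠ 0) :
    Coplanar ℝ (C.surface U) := by
  have hne_all (t : ℝ) (ht : t ∈ C.I) := radial_two_ne_zero_of_ne_zero hU hmin hs ht hne
  refine coplanar_of_inner_eq_const finrank_euclideanSpace_fin (cross_frame_ne_zero hs)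
    (k := inner ℝ (cross (C.u s) (C.v s)) (C.c s)) ?_
  rintro _ ⟨⟨t, θ⟩, hp, rfl⟩
  have ht := hU.2.1 _ hp
  have hnormal : cross (C.u s) (C.v s) = cross (C.u t) (C.v t) :=
    eq_of_hasDerivAt_eq_zero C.isOpen_I C.ordConnected_I
      (fun x hx => hasDerivAt_cross_frame hU hmin hx (hne_all x hx)) hs ht
  have hoffset := eq_of_hasDerivAt_eq_zero C.isOpen_I C.ordConnected_I
    (fun x hx => hasDerivAt_inner_cross_frame_c hU hmin hx (hne_all x hx)) hs ht
  rw [hoffset, hnormal, inner_cross_frame_param]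

end Minimal

end CircleFamily

theorem theorem1p3 (C : CircleFamily) (U : Set (ℝ × ℝ)) (hU : C.IsDomain U)
    (hmin : IsDirichletMinimalOn C.param U)
    (hplane : ¬ Coplanar ℝ (C.surface U)) :
    ∀ s ∈ C.I, (C.plane s).Parallel xyPlane := by
  intro s hs
  refine CircleFamily.plane_parallel_xyPlane hs ?_
  by_contra hne
  exact hplane (CircleFamily.coplanar_surface_of_radial_two_ne_zero hU hmin hs hne)
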